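/- Let $A$ be a transcendental entire function. Suppose that $A^{-1}$ has a logarithmic singularity over $\infty$, that is: there is a path $\gamma:[0,\infty)\to\mathbb{C}$ tending to infinity with $A(z)\to\infty$ as $z\to\infty$ on $\gamma$ and, writing $\Omega_M$ for $M>0$ for the connected component of $\{z\in\mathbb{C}:|A(z)|>M\}$ such that $\gamma\setminus\Omega_M$ is bounded (the sets $\Omega_M$ are called the neighbourhoods of the singularity), there exists $M_0>0$ such that an analytic branch of $w=\log A(z)$ maps $\Omega_{M_0}$ univalently onto the half-plane $\operatorname{Re} w>\log M_0$. Then for every $M>0$ there exists a path $\Gamma\subseteq\Omega_M$ tending to infinity such that every solution $y$ of $$y''+A(z)y=0$$ in $\mathbb{C}$ satisfies $y(z)\to 0$ as $z\to\infty$ on $\Gamma$. -/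

import Mathlib

open Filter Topology
open scoped NNReal

/-- An entire function `ℂ → ℂ` that is not a polynomial. -/
def IsTranscendentalEntire (f : ℂ → ℂ) : Prop :=
  Differentiable ℂ f ∧ ¬ ∃ p : Polynomial ℂ, ∀ z, f z = p.eval z

/-- A path `[0, ∞) → ℂ` tending to infinity. -/
def IsPathToInfinity (γ : ℝ≥0 → ℂ) : Prop :=
  Continuous γ ∧ Tendsto γ atTop (Bornology.cobounded ℂ)

/-- `γ` is a path tending to infinity on which `f` tends to infinity: it determines a
transcendental singularity of `f⁻¹` over the asymptotic value `∞`. -/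
def DeterminesSingularityOverInfinity (f : ℂ → ℂ) (γ : ℝ≥0 → ℂ) : Prop :=
  IsPathToInfinity γ ∧ Tendsto (fun t => f (γ t)) atTop (Bornology.cobounded ℂ)

/-- `Ω` is the neighbourhood, with parameter `M > 0`, of the singularity over `∞` of the inverse
of the entire function `f` determined by `γ`: a connected component of `{z | M < |f z|}` outside
of which only a bounded part of `γ` lies. -/
def IsSingularityNhd (f : ℂ → ℂ) (γ : ℝ≥0 → ℂ) (M : ℝ) (Ω : Set ℂ) : Prop :=
  0 < M ∧ (∃ z₀ ∈ {z : ℂ | M < ‖f z‖}, Ω = connectedComponentIn {z : ℂ | M < ‖f z‖} z₀) ∧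
    Bornology.IsBounded (Set.range γ \ Ω)

/-- The singularity over `∞` determined by `γ` is logarithmic: for some `M > 0` an analytic branch
of `log f` maps the neighbourhood with parameter `M` univalently onto `{w | log M < Re w}`.
(As `f` is entire it has no poles, so the singularity is automatically direct.) -/
def IsLogarithmicSingularity (f : ℂ → ℂ) (γ : ℝ≥0 → ℂ) : Prop :=
  DeterminesSingularityOverInfinity f γ ∧
    ∃ (M : ℝ) (Ω : Set ℂ), IsSingularityNhd f γ M Ω ∧
      ∃ L : ℂ → ℂ, DifferentiableOn ℂ L Ω ∧ (∀ z ∈ Ω, Complex.exp (L z) = f z) ∧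
        Set.BijOn L Ω {w : ℂ | Real.log M < w.re}

/-- `y` is an (entire) solution of `y'' + A y = 0`. -/
def IsSolution (A y : ℂ → ℂ) : Prop :=
  Differentiable ℂ y ∧ ∀ z, deriv (deriv y) z + A z * y z = 0

/-! Let `φ` be the inverse of the branch of `log A`, so `A (φ w) = exp w` on a half-plane `Re w >
a`. With `exp h = exp (w / 2) * φ'`, `U = exp (w / 4) * y (φ w)` and a suitable companion `W`, the
equation becomes `U' = e^h W`, `W' = -e^h U + (1/4 - h') e^{-h} U / 4`. On a curve along which `e^h
dw` is real, the main part is a rotation and preserves `|U|² + |W|²`. If moreover `Re h` grows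
linearly there, the perturbation is integrable. Hence `U` is bounded, and `y = exp (-w / 4) * U`
tends to zero as `Re w → ∞`.

Such a curve exists because `h' = 1/2 + φ''/φ'` is close to `1/2` far to the right: univalence of
`φ` on the disc of radius `Re w - a` about `w` gives `|φ''/φ'| ≤ C / (Re w - a)`
(`norm_deriv_deriv_le_of_injOn_ball`). The curve solves a scalar ODE
(`exists_curve_exp_mul_deriv_real`) and depends on `h` only, so it serves all solutions `y` at once
(`tendsto_solution_along_curve`). Its image under `φ` is `Γ`. -/

/-! ### Inverses of injective holomorphic functions. -/

/-- A holomorphic function that is injective near `z` is open at `z`. -/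
theorem nhds_le_map_nhds_of_injOn {f : ℂ → ℂ} {U : Set ℂ} (hU : IsOpen U)
    (hf : DifferentiableOn ℂ f U) (hinj : Set.InjOn f U) {z : ℂ} (hz : z ∈ U) :
    𝓝 (f z) ≤ map f (𝓝 z) := by
  have hUz : U ∈ 𝓝 z := hU.mem_nhds hz
  refine (hf.analyticAt hUz).eventually_constant_or_nhds_le_map_nhds.resolve_left fun h => ?_
  have h1 : ∀ᶠ ζ in 𝓝[≠] z, False := by
    filter_upwards [nhdsWithin_le_nhds h, nhdsWithin_le_nhds hUz, self_mem_nhdsWithin]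
      with ζ h1 h2 h3
    exact h3 (hinj h2 hz h1)
  exact h1.exists.elim fun _ h => h

theorem continuousAt_leftInvOn {f g : ℂ → ℂ} {U : Set ℂ} (hU : IsOpen U)
    (hf : DifferentiableOn ℂ f U) (hg : Set.LeftInvOn g f U) {z : ℂ} (hz : z ∈ U) :
    ContinuousAt g (f z) := by
  have h1 : Tendsto g (map f (𝓝 z)) (𝓝 z) := by
    rw [tendsto_map'_iff]
    refine tendsto_id.congr' ?_
    filter_upwards [hU.mem_nhds hz] with ζ hζ
    exact (hg hζ).symm
  rw [ContinuousAt, hg hz]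
  exact h1.mono_left (nhds_le_map_nhds_of_injOn hU hf hg.injOn hz)

theorem isOpen_image_of_injOn {f : ℂ → ℂ} {U : Set ℂ} (hU : IsOpen U)
    (hf : DifferentiableOn ℂ f U) (hinj : Set.InjOn f U) : IsOpen (f '' U) := by
  rw [isOpen_iff_mem_nhds]
  rintro _ ⟨z, hz, rfl⟩
  exact nhds_le_map_nhds_of_injOn hU hf hinj hz (image_mem_map (hU.mem_nhds hz))

/-- A left inverse of an injective holomorphic function is holomorphic on the image. -/
theorem differentiableAt_leftInvOn {f g : ℂ → ℂ} {U : Set ℂ} (hU : IsOpen U)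
    (hf : DifferentiableOn ℂ f U) (hg : Set.LeftInvOn g f U) {z : ℂ} (hz : z ∈ U) :
    DifferentiableAt ℂ g (f z) := by
  have hUz : U ∈ 𝓝 z := hU.mem_nhds hz
  have himg : f '' U ∈ 𝓝 (f z) :=
    (isOpen_image_of_injOn hU hf hg.injOn).mem_nhds (Set.mem_image_of_mem f hz)
  -- Zeros of `f'` are isolated, so `g` is differentiable on a punctured neighbourhood of `f z`;
  -- continuity of `g` then makes the singularity at `f z` removable.
  have hne : ∀ᶠ ζ in 𝓝[≠] z, deriv f ζ ≠ 0 := by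
    refine (hf.analyticAt hUz).deriv.eventually_eq_zero_or_eventually_ne_zero.resolve_left
      fun h => ?_
    obtain ⟨r, hr, hball⟩ := Metric.mem_nhds_iff.1 (h.and hUz)
    have hfr : DifferentiableOn ℂ f (Metric.ball z r) := hf.mono fun ζ hζ => (hball hζ).2
    have hconst : ∀ ζ ∈ Metric.ball z r, ζ = z := fun ζ hζ => by
      refine hg.injOn (hball hζ).2 hz ?_
      exact Metric.isOpen_ball.is_const_of_deriv_eq_zero
        (convex_ball z r).isPreconnected hfr (fun x hx => (hball hx).1) hζ
        (Metric.mem_ball_self hr)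
    have h1 : ∀ᶠ ζ in 𝓝[≠] z, False := by
      filter_upwards [nhdsWithin_le_nhds (Metric.ball_mem_nhds z hr), self_mem_nhdsWithin]
        with ζ h1 h2
      exact h2 (hconst ζ h1)
    exact h1.exists.elim fun _ h => h
  have hgt : Tendsto g (𝓝[≠] (f z)) (𝓝[≠] z) := by
    refine tendsto_nhdsWithin_iff.2 ⟨?_, ?_⟩
    · have h1 := continuousAt_leftInvOn hU hf hg hz
      rw [ContinuousAt, hg hz] at h1
      exact h1.mono_left nhdsWithin_le_nhds
    · filter_upwards [nhdsWithin_le_nhds himg, self_mem_nhdsWithin] with w hw hne h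
      obtain ⟨ζ, hζ, rfl⟩ := hw
      rw [Set.mem_singleton_iff, hg hζ] at h
      exact hne (by rw [h]; rfl)
  refine (Complex.analyticAt_of_differentiable_on_punctured_nhds_of_continuousAt ?_
    (continuousAt_leftInvOn hU hf hg hz)).differentiableAt
  filter_upwards [hgt.eventually hne, nhdsWithin_le_nhds himg] with w hw hwi
  obtain ⟨ζ, hζ, rfl⟩ := hwi
  rw [hg hζ] at hw
  refine (HasDerivAt.of_local_left_inverse (f := f) (f' := deriv f ζ)
    (continuousAt_leftInvOn hU hf hg hζ) ?_ hw ?_).differentiableAt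
  · rw [hg hζ]
    exact (hf.differentiableAt (hU.mem_nhds hζ)).hasDerivAt
  · filter_upwards [(isOpen_image_of_injOn hU hf hg.injOn).mem_nhds
      (Set.mem_image_of_mem f hζ)] with y hy
    obtain ⟨x, hx, rfl⟩ := hy
    rw [hg hx]

theorem deriv_leftInvOn_mul_deriv {f g : ℂ → ℂ} {U : Set ℂ} (hU : IsOpen U)
    (hf : DifferentiableOn ℂ f U) (hg : Set.LeftInvOn g f U) {z : ℂ} (hz : z ∈ U) :
    deriv g (f z) * deriv f z = 1 := by
  have h1 := (differentiableAt_leftInvOn hU hf hg hz).hasDerivAt.comp z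
    (hf.differentiableAt (hU.mem_nhds hz)).hasDerivAt
  refine h1.unique ((hasDerivAt_id z).congr_of_eventuallyEq ?_)
  filter_upwards [hU.mem_nhds hz] with ζ hζ
  exact hg hζ

theorem deriv_ne_zero_of_injOn {f : ℂ → ℂ} {U : Set ℂ} (hU : IsOpen U)
    (hf : DifferentiableOn ℂ f U) (hinj : Set.InjOn f U) {z : ℂ} (hz : z ∈ U) :
    deriv f z ≠ 0 :=
  right_ne_zero_of_mul_eq_one (deriv_leftInvOn_mul_deriv hU hf hinj.leftInvOn_invFunOn hz)

/-! ### Logarithms and a distortion estimate for univalent functions. -/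

/-- A nonvanishing holomorphic function on a convex open set has a holomorphic logarithm. -/
theorem exists_differentiableOn_exp_eq {f : ℂ → ℂ} {U : Set ℂ} (hU : IsOpen U)
    (hc : Convex ℝ U) (hne : U.Nonempty) (hf : DifferentiableOn ℂ f U)
    (h0 : ∀ z ∈ U, f z ≠ 0) :
    ∃ g : ℂ → ℂ, DifferentiableOn ℂ g U ∧ ∀ z ∈ U, Complex.exp (g z) = f z := by
  have hs : IsSimplyConnected U := by
    have := hc.contractibleSpace hne
    exact (inferInstance : SimplyConnectedSpace U)
  obtain ⟨g, hgc, hg⟩ := Complex.exists_continuousOn_eqOn_exp_comp hs hU hf.continuousOn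
    (by rintro ⟨z, hz, h⟩; exact h0 z hz h)
  refine ⟨g, fun z hz => DifferentiableAt.differentiableWithinAt ?_, fun z hz => hg hz⟩
  have hUz := hU.mem_nhds hz
  have hgz : ContinuousAt g z := hgc.continuousAt hUz
  -- Near `z` the continuous logarithm agrees with a shifted principal branch, which is holomorphic.
  have hloc : HasDerivAt (fun ζ => Complex.log (f ζ / f z) + g z) (deriv f z / f z) z := by
    have h1 : HasDerivAt (fun ζ => f ζ / f z) (deriv f z / f z) z :=
      (hf.differentiableAt hUz).hasDerivAt.div_const _
    have h2 := h1.clog (by simp [div_self (h0 z hz)])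
    simpa [div_self (h0 z hz)] using h2.add_const (g z)
  refine (hloc.congr_of_eventuallyEq ?_).differentiableAt
  have hsub : Tendsto (fun ζ => (g ζ - g z).im) (𝓝 z) (𝓝 0) := by
    have h3 : ContinuousAt (fun ζ => (g ζ - g z).im) z :=
      Complex.continuous_im.continuousAt.comp (hgz.sub continuousAt_const)
    simpa [ContinuousAt] using h3
  filter_upwards [hUz, hsub.eventually (Ioo_mem_nhds (neg_lt_zero.2 Real.pi_pos) Real.pi_pos)]
    with ζ hζ hi
  have h4 : f ζ / f z = Complex.exp (g ζ - g z) := by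
    rw [Complex.exp_sub]
    exact congrArg₂ _ (hg hζ).symm (hg hz).symm
  rw [h4, Complex.log_exp hi.1 hi.2.le]
  ring

/-- Schwarz's lemma for the inverse function, which maps the disc of radius `d` into one of radius
`R`. -/
theorem le_mul_norm_deriv_of_ball_subset_image {f : ℂ → ℂ} {c : ℂ} {R d : ℝ} (hR : 0 < R)
    (hf : DifferentiableOn ℂ f (Metric.ball c R)) (hinj : Set.InjOn f (Metric.ball c R))
    (hd : 0 < d) (hsub : Metric.ball (f c) d ⊆ f '' Metric.ball c R) :
    d ≤ R * ‖deriv f c‖ := by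
  have hinv := hinj.leftInvOn_invFunOn
  set g := Function.invFunOn f (Metric.ball c R)
  have hcm : c ∈ Metric.ball c R := Metric.mem_ball_self hR
  have hg : DifferentiableOn ℂ g (Metric.ball (f c) d) := by
    intro w hw
    obtain ⟨z, hz, rfl⟩ := hsub hw
    exact (differentiableAt_leftInvOn Metric.isOpen_ball hf hinv hz).differentiableWithinAt
  have hmaps : Set.MapsTo g (Metric.ball (f c) d) (Metric.closedBall (g (f c)) R) := by
    intro w hw
    obtain ⟨z, hz, rfl⟩ := hsub hw
    rw [hinv hz, hinv hcm]
    exact Metric.ball_subset_closedBall hz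
  have h1 := Complex.norm_deriv_le_div_of_mapsTo_ball hg hmaps hd
  have h2 := congrArg norm (deriv_leftInvOn_mul_deriv Metric.isOpen_ball hf hinv hcm)
  rw [norm_mul, norm_one] at h2
  rw [le_div_iff₀ hd] at h1
  calc d = ‖deriv g (f c)‖ * d * ‖deriv f c‖ := by linear_combination (-d) * h2
    _ ≤ R * ‖deriv f c‖ := by gcongr

/-- An injective holomorphic function on a disc omits a value `ω` such that its image contains
the open disc around `f c` through `ω`. -/
theorem exists_omitted_value {f : ℂ → ℂ} {c : ℂ} {R : ℝ} (hR : 0 < R)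
    (hf : DifferentiableOn ℂ f (Metric.ball c R)) (hinj : Set.InjOn f (Metric.ball c R)) :
    ∃ ω, ω ∉ f '' Metric.ball c R ∧
      Metric.ball (f c) ‖f c - ω‖ ⊆ f '' Metric.ball c R := by
  have hopen := isOpen_image_of_injOn Metric.isOpen_ball hf hinj
  have hne : (f '' Metric.ball c R)ᶜ.Nonempty := by
    by_contra h
    rw [Set.not_nonempty_iff_eq_empty, Set.compl_empty_iff] at h
    have h1 := le_mul_norm_deriv_of_ball_subset_image hR hf hinj
      (d := R * ‖deriv f c‖ + 1) (by positivity) (h ▸ Set.subset_univ _)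
    linarith
  obtain ⟨ω, hω, hd⟩ := hopen.isClosed_compl.exists_infDist_eq_dist hne (f c)
  refine ⟨ω, hω, fun w hw => ?_⟩
  by_contra hn
  have h2 := Metric.infDist_le_dist_of_mem (s := (f '' Metric.ball c R)ᶜ) (x := f c) (y := w) hn
  rw [hd, dist_eq_norm] at h2
  rw [Metric.mem_ball, dist_comm] at hw
  linarith

/-- An injective holomorphic function on a disc is a quadratic polynomial in `1 / k` for a
holomorphic function `k` bounded by an absolute constant. -/
theorem exists_bounded_representation {f : ℂ → ℂ} {c : ℂ} {R : ℝ} (hR : 0 < R)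
    (hf : DifferentiableOn ℂ f (Metric.ball c R)) (hinj : Set.InjOn f (Metric.ball c R)) :
    ∃ (D : ℂ) (k : ℂ → ℂ), ‖D‖ ≤ R * ‖deriv f c‖ ∧ DifferentiableOn ℂ k (Metric.ball c R) ∧
      k c = 1 / 2 ∧ (∀ z ∈ Metric.ball c R, k z ≠ 0 ∧ ‖k z‖ ≤ 5 / 2 ∧
        f z = f c - D + D * (1 / k z - 1) ^ 2) := by
  have hcm : c ∈ Metric.ball c R := Metric.mem_ball_self hR
  obtain ⟨ω, hω, hsub⟩ := exists_omitted_value hR hf hinj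
  have hne : ∀ z ∈ Metric.ball c R, f z - ω ≠ 0 := fun z hz h =>
    hω ⟨z, hz, sub_eq_zero.1 h⟩
  have hD0 : f c - ω ≠ 0 := hne c hcm
  have hdpos : 0 < ‖f c - ω‖ := norm_pos_iff.2 hD0
  obtain ⟨ℓ, hℓ, hexp⟩ := exists_differentiableOn_exp_eq Metric.isOpen_ball (convex_ball c R)
    ⟨c, hcm⟩ (f := fun z => f z - ω) (hf.sub_const ω) hne
  -- The branch of the square root of `(f - ω) / (f c - ω)` with value `1` at `c`.
  set g : ℂ → ℂ := fun z => Complex.exp ((ℓ z - ℓ c) / 2) with hgdef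
  have hgd : DifferentiableOn ℂ g (Metric.ball c R) := by
    exact ((hℓ.sub_const _).div_const _).cexp
  have hgc : g c = 1 := by simp [hgdef]
  have hfg : ∀ z ∈ Metric.ball c R, f z - ω = (f c - ω) * g z ^ 2 := by
    intro z hz
    rw [← hexp z hz, ← hexp c hcm, hgdef, ← Complex.exp_nat_mul, ← Complex.exp_add]
    congr 1
    push_cast
    ring
  have hinv := hinj.leftInvOn_invFunOn
  set F := Function.invFunOn f (Metric.ball c R)
  -- the branch of the square root has positive real part where `f` is close to `f c`
  have hre : ∀ z ∈ Metric.ball c R, ‖g z ^ 2 - 1‖ < 1 → 0 < (g z).re := by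
    have hcont : ContinuousOn (fun w => (g (F w)).re) (Metric.ball (f c) ‖f c - ω‖) := by
      intro w hw
      obtain ⟨z, hz, rfl⟩ := hsub hw
      refine ContinuousAt.continuousWithinAt ?_
      refine Complex.continuous_re.continuousAt.comp (ContinuousAt.comp (g := g) ?_
        (continuousAt_leftInvOn Metric.isOpen_ball hf hinv hz))
      rw [hinv hz]
      exact (hgd.differentiableAt (Metric.isOpen_ball.mem_nhds hz)).continuousAt
    intro z hz hz1
    have hmem : ∀ z ∈ Metric.ball c R, (f z ∈ Metric.ball (f c) ‖f c - ω‖ ↔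
        ‖g z ^ 2 - 1‖ < 1) := by
      intro z hz
      have h1 : f z - f c = (f c - ω) * (g z ^ 2 - 1) := by
        linear_combination hfg z hz
      rw [Metric.mem_ball, dist_eq_norm, h1, norm_mul]
      constructor
      · intro h
        by_contra h2
        nlinarith
      · intro h
        nlinarith
    by_contra hneg
    rw [not_lt] at hneg
    obtain ⟨w, hw, hw0⟩ := (convex_ball (f c) ‖f c - ω‖).isPreconnected.intermediate_value
      ((hmem z hz).2 hz1) (Metric.mem_ball_self hdpos) hcont
      (show (0 : ℝ) ∈ Set.Icc _ _ by
        refine ⟨by simpa only [hinv hz] using hneg, ?_⟩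
        simp only [hinv hcm, hgc]
        simp)
    obtain ⟨ζ, hζ, rfl⟩ := hsub hw
    -- If `g ζ` were purely imaginary, `g ζ ^ 2 - 1` would have real part at most `-1`,
    -- contradicting `h2`.
    have h2 := (hmem ζ hζ).1 hw
    simp only [hinv hζ] at hw0
    have h3 := (Complex.abs_re_le_norm (g ζ ^ 2 - 1)).trans_lt h2
    have h4 : (g ζ ^ 2 - 1).re = - (g ζ).im ^ 2 - 1 := by
      simp [pow_two, hw0]
    rw [h4, abs_lt] at h3
    nlinarith [sq_nonneg (g ζ).im]
  -- Values of `g` near `-1` have squares near `1`, where `hre` forces `Re g > 0`. The constant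
  -- works because `(2/5) * (2/5 + 2) < 1`.
  have hbig : ∀ z ∈ Metric.ball c R, 2 / 5 ≤ ‖g z + 1‖ := by
    intro z hz
    by_contra h
    rw [not_le] at h
    have h1 : ‖g z ^ 2 - 1‖ < 1 := by
      have h2 : g z ^ 2 - 1 = (g z + 1) * ((g z + 1) - 2) := by ring
      have h3 : ‖(g z + 1) - 2‖ ≤ ‖g z + 1‖ + 2 := (norm_sub_le _ _).trans (by simp)
      rw [h2, norm_mul]
      nlinarith [norm_nonneg (g z + 1), norm_nonneg ((g z + 1) - 2)]
    have h4 := hre z hz h1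
    have h5 := Complex.re_le_norm (g z + 1)
    simp only [Complex.add_re, Complex.one_re] at h5
    linarith
  have hg1 : ∀ z ∈ Metric.ball c R, g z + 1 ≠ 0 := fun z hz h => by
    have := hbig z hz
    rw [h, norm_zero] at this
    norm_num at this
  refine ⟨f c - ω, fun z => (g z + 1)⁻¹,
    le_mul_norm_deriv_of_ball_subset_image hR hf hinj hdpos hsub,
    (hgd.add_const 1).inv hg1, by simp only [hgc]; norm_num, fun z hz => ⟨inv_ne_zero (hg1 z hz), ?_, ?_⟩⟩
  · rw [norm_inv, inv_le_comm₀ (norm_pos_iff.2 (hg1 z hz)) (by norm_num)]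
    have := hbig z hz
    norm_num
    linarith
  · rw [one_div, inv_inv]
    linear_combination hfg z hz

/-- A form of Bieberbach's estimate of the second coefficient of a univalent function. -/
theorem norm_deriv_deriv_le_of_injOn_ball {f : ℂ → ℂ} {c : ℂ} {R : ℝ} (hR : 0 < R)
    (hf : DifferentiableOn ℂ f (Metric.ball c R)) (hinj : Set.InjOn f (Metric.ball c R)) :
    ‖deriv (deriv f) c‖ ≤ 1760 / R * ‖deriv f c‖ := by
  obtain ⟨D, k, hD, hk, hkc, hrep⟩ := exists_bounded_representation hR hf hinj
  have hcm : c ∈ Metric.ball c R := Metric.mem_ball_self hR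
  have hkd : ∀ z ∈ Metric.ball c R, HasDerivAt k (deriv k z) z := fun z hz =>
    (hk.differentiableAt (Metric.isOpen_ball.mem_nhds hz)).hasDerivAt
  have hf1 : ∀ z ∈ Metric.ball c R,
      deriv f z = 2 * D * ((1 / k z - 1) * (-deriv k z / k z ^ 2)) := by
    intro z hz
    have h1 := (((((hkd z hz).fun_inv (hrep z hz).1).sub_const 1).pow 2).const_mul D).const_add
      (f c - D)
    refine (h1.congr_of_eventuallyEq ?_).deriv.trans ?_
    · filter_upwards [Metric.isOpen_ball.mem_nhds hz] with ζ hζ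
      rw [(hrep ζ hζ).2.2, one_div]
      rfl
    · simp only [one_div]
      push_cast
      ring
  have hk2 : HasDerivAt (deriv k) (deriv (deriv k) c) c :=
    (hk.analyticAt (Metric.isOpen_ball.mem_nhds hcm)).deriv.differentiableAt.hasDerivAt
  have hf2 : deriv (deriv f) c =
      2 * D * (32 * deriv k c ^ 2 - 4 * deriv (deriv k) c) := by
    have h1 : HasDerivAt (fun z => 2 * D * (((k z)⁻¹ - 1) * (-deriv k z / k z ^ 2))) _ c :=
      (((((hkd c hcm).fun_inv (hrep c hcm).1).sub_const 1).mul
      (hk2.neg.div ((hkd c hcm).pow 2) (pow_ne_zero 2 (hrep c hcm).1))).const_mul (2 * D))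
    refine (h1.congr_of_eventuallyEq ?_).deriv.trans ?_
    · filter_upwards [Metric.isOpen_ball.mem_nhds hcm] with ζ hζ
      rw [hf1 ζ hζ, one_div]
    · simp only [Pi.pow_apply, Pi.neg_apply, Pi.div_apply, hkc]
      push_cast
      ring
  -- Cauchy's estimates on the circle of radius `R / 2` bound the first two derivatives of `k` at
  -- `c`.
  have hsub : Metric.closedBall c (R / 2) ⊆ Metric.ball c R :=
    Metric.closedBall_subset_ball (half_lt_self hR)
  have hcl : DiffContOnCl ℂ k (Metric.ball c (R / 2)) :=
    (hk.mono hsub).diffContOnCl_ball subset_rfl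
  have hsph : ∀ z ∈ Metric.sphere c (R / 2), ‖k z‖ ≤ 5 / 2 := fun z hz =>
    (hrep z (hsub (Metric.sphere_subset_closedBall hz))).2.1
  have hb1 : ‖deriv k c‖ ≤ 5 / R :=
    (Complex.norm_deriv_le_of_forall_mem_sphere_norm_le (by positivity) hcl hsph).trans_eq
      (by field_simp)
  have hb2 : ‖deriv (deriv k) c‖ ≤ 20 / R ^ 2 := by
    have h1 := Complex.norm_iteratedDeriv_le_of_forall_mem_sphere_norm_le 2 (by positivity) hcl hsph
    rw [iteratedDeriv_succ, iteratedDeriv_one] at h1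
    refine h1.trans_eq ?_
    simp only [Nat.factorial]
    push_cast
    field_simp
    norm_num
  calc ‖deriv (deriv f) c‖ ≤ 2 * ‖D‖ * (32 * ‖deriv k c‖ ^ 2 + 4 * ‖deriv (deriv k) c‖) := by
        rw [hf2, norm_mul, norm_mul]
        simp only [Complex.norm_ofNat]
        gcongr
        refine (norm_sub_le _ _).trans_eq ?_
        simp
    _ ≤ 2 * (R * ‖deriv f c‖) * (32 * (5 / R) ^ 2 + 4 * (20 / R ^ 2)) := by gcongr
    _ = 1760 / R * ‖deriv f c‖ := by
        field_simp
        ring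

/-! ### Global solvability of a scalar ODE and the clamped tangent. -/

/-- Global existence for a scalar ODE whose right-hand side is bounded and uniformly Lipschitz in
the unknown. -/
theorem exists_global_solution {g : ℝ → ℝ → ℝ} {K B : ℝ≥0} (hK : ∀ t, LipschitzWith K (g t))
    (hc : ∀ v, Continuous fun t => g t v) (hB : ∀ t v, ‖g t v‖ ≤ B) (t₀ v₀ : ℝ) :
    ∃ v : ℝ → ℝ, v t₀ = v₀ ∧ ∀ t, HasDerivAt v (g t (v t)) t := by
  have hloc : ∀ T : ℝ≥0, ∃ v : ℝ → ℝ, v t₀ = v₀ ∧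
      ∀ t ∈ Set.Ioo (t₀ - T) (t₀ + T), HasDerivAt v (g t (v t)) t := by
    intro T
    have hmem : t₀ ∈ Set.Icc (t₀ - T) (t₀ + T) :=
      ⟨by linarith [T.coe_nonneg], by linarith [T.coe_nonneg]⟩
    -- A solution with speed at most `B` moves at most `B * T` in time `T`, so this radius never
    -- restricts the existence interval.
    have hPL : IsPicardLindelof g (⟨t₀, hmem⟩ : Set.Icc (t₀ - (T : ℝ)) (t₀ + T)) v₀ (B * T) 0 B K :=
      { lipschitzOnWith := fun t _ => (hK t).lipschitzOnWith
        continuousOn := fun v _ => (hc v).continuousOn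
        norm_le := fun t _ v _ => hB t v
        mul_max_le := by simp }
    obtain ⟨v, hv0, hv⟩ := hPL.exists_eq_forall_mem_Icc_hasDerivWithinAt₀
    exact ⟨v, hv0, fun t ht => (hv t (Set.Ioo_subset_Icc_self ht)).hasDerivAt
      (Icc_mem_nhds ht.1 ht.2)⟩
  choose V hV0 hV using hloc
  have huniq : ∀ S T : ℝ≥0, S ≤ T → Set.EqOn (V S) (V T) (Set.Ioo (t₀ - S) (t₀ + S)) := by
    intro S T hST t ht
    have hST' : (S : ℝ) ≤ T := hST
    have hS : 0 < (S : ℝ) := by linarith [ht.1, ht.2]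
    refine ODE_solution_unique_of_mem_Ioo (v := g) (K := K) (s := fun _ => Set.univ)
      (fun t _ => (hK t).lipschitzOnWith) (t₀ := t₀) ⟨by linarith, by linarith⟩
      (fun t ht => ⟨hV S t ht, trivial⟩) (fun t ht => ⟨hV T t ⟨?_, ?_⟩, trivial⟩)
      ((hV0 S).trans (hV0 T).symm) ht
    · linarith [ht.1]
    · linarith [ht.2]
  have hmem : ∀ t : ℝ, t ∈ Set.Ioo (t₀ - (‖t - t₀‖₊ + 1 : ℝ≥0)) (t₀ + (‖t - t₀‖₊ + 1 : ℝ≥0)) := by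
    intro t
    have h1 := abs_le.1 (le_refl |t - t₀|)
    simp only [NNReal.coe_add, coe_nnnorm, Real.norm_eq_abs, NNReal.coe_one]
    constructor <;> linarith [h1.1, h1.2]
  -- The local solutions agree on common intervals; at time `t` any one defined beyond `t` may be
  -- used.
  refine ⟨fun t => V (‖t - t₀‖₊ + 1) t, hV0 _, fun t => ?_⟩
  refine (hV _ t (hmem t)).congr_of_eventuallyEq ?_
  filter_upwards [isOpen_Ioo.mem_nhds (hmem t)] with s hs
  rcases le_total (‖s - t₀‖₊ + 1) (‖t - t₀‖₊ + 1) with h | h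
  · exact huniq _ _ h (hmem s)
  · exact (huniq _ _ h hs).symm

theorem half_le_cos_sq {s : ℝ} (hs : s ∈ Set.Icc (-(Real.pi / 4)) (Real.pi / 4)) :
    1 / 2 ≤ Real.cos s ^ 2 := by
  have h1 : Real.cos (Real.pi / 4) ≤ Real.cos |s| :=
    Real.cos_le_cos_of_nonneg_of_le_pi (abs_nonneg s) (by linarith [Real.pi_pos])
      (abs_le.2 hs)
  rw [Real.cos_abs, Real.cos_pi_div_four] at h1
  calc (1 : ℝ) / 2 = (√2 / 2) ^ 2 := by rw [div_pow, Real.sq_sqrt zero_le_two]; norm_num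
    _ ≤ _ := by gcongr

theorem cos_pos_of_mem_Icc_pi_div_four {s : ℝ}
    (hs : s ∈ Set.Icc (-(Real.pi / 4)) (Real.pi / 4)) : 0 < Real.cos s :=
  Real.cos_pos_of_mem_Ioo ⟨by linarith [hs.1, Real.pi_pos], by linarith [hs.2, Real.pi_pos]⟩

theorem lipschitzOnWith_tan :
    LipschitzOnWith 2 Real.tan (Set.Icc (-(Real.pi / 4)) (Real.pi / 4)) := by
  refine (convex_Icc _ _).lipschitzOnWith_of_nnnorm_hasDerivWithin_le
    (f' := fun s => 1 / Real.cos s ^ 2)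
    (fun s hs => (Real.hasDerivAt_tan (cos_pos_of_mem_Icc_pi_div_four hs).ne').hasDerivWithinAt)
    fun s hs => ?_
  have h1 := half_le_cos_sq hs
  rw [← NNReal.coe_le_coe, coe_nnnorm, Real.norm_eq_abs, abs_of_nonneg (by positivity),
    div_le_iff₀ (by linarith)]
  push_cast
  linarith

theorem abs_tan_le_one {s : ℝ} (hs : s ∈ Set.Icc (-(Real.pi / 4)) (Real.pi / 4)) :
    |Real.tan s| ≤ 1 := by
  have h1 := half_le_cos_sq hs
  have h2 := Real.sin_sq_add_cos_sq s
  rw [Real.tan_eq_sin_div_cos, abs_div, div_le_one (abs_pos.2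
    (cos_pos_of_mem_Icc_pi_div_four hs).ne')]
  exact sq_le_sq.1 (by linarith)

/-- The tangent function, made constant outside of `[-π/4, π/4]`. -/
noncomputable def clampedTan (s : ℝ) : ℝ :=
  Real.tan (Set.projIcc (-(Real.pi / 4)) (Real.pi / 4) (by linarith [Real.pi_pos]) s)

/-- Clamping makes the slope field of the curve bounded and globally Lipschitz, as
`exists_global_solution` requires. -/
theorem lipschitzWith_clampedTan : LipschitzWith 2 clampedTan := by
  have h1 : LipschitzWith 2 fun s : Set.Icc (-(Real.pi / 4)) (Real.pi / 4) => Real.tan s :=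
    lipschitzOnWith_tan.to_restrict
  have h2 := h1.comp (LipschitzWith.projIcc (show -(Real.pi / 4) ≤ Real.pi / 4 by
    linarith [Real.pi_pos]))
  rwa [mul_one] at h2

theorem abs_clampedTan_le_one (s : ℝ) : |clampedTan s| ≤ 1 :=
  abs_tan_le_one (Subtype.prop _)

theorem clampedTan_of_mem {s : ℝ} (hs : s ∈ Set.Icc (-(Real.pi / 4)) (Real.pi / 4)) :
    clampedTan s = Real.tan s := by
  rw [clampedTan, Set.projIcc_of_mem _ hs]

/-! ### The curve along which `exp h dw` is real. -/

theorem hasDerivAt_im {f : ℝ → ℂ} {f' : ℂ} {t : ℝ} (hf : HasDerivAt f f' t) :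
    HasDerivAt (fun s => (f s).im) f'.im t :=
  Complex.imCLM.hasFDerivAt.comp_hasDerivAt t hf

theorem hasDerivAt_re {f : ℝ → ℂ} {f' : ℂ} {t : ℝ} (hf : HasDerivAt f f' t) :
    HasDerivAt (fun s => (f s).re) f'.re t :=
  Complex.reCLM.hasFDerivAt.comp_hasDerivAt t hf

/-- Restricting a holomorphic function to a vertical line. -/
theorem hasDerivAt_im_vertical {h : ℂ → ℂ} {x v : ℝ}
    (hd : DifferentiableAt ℂ h (x + v * Complex.I)) :
    HasDerivAt (fun s : ℝ => (h (x + s * Complex.I)).im)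
      (deriv h (x + v * Complex.I)).re v := by
  have h1 : HasDerivAt (fun s : ℝ => (x : ℂ) + s * Complex.I) Complex.I v := by
    simpa using ((Complex.ofRealCLM.hasDerivAt (x := v)).mul_const Complex.I).const_add (x : ℂ)
  simpa using hasDerivAt_im (hd.hasDerivAt.comp v h1)

/-- If the derivative of `h` is close to `1 / 2` on a right half-plane, then there is a curve in the half-plane,
parametrised by the real part, along which `exp h dw` is real and `Re h` grows at least
linearly. -/
theorem exists_curve_exp_mul_deriv_real {h : ℂ → ℂ} {x₀ : ℝ}
    (hd : ∀ w : ℂ, x₀ ≤ w.re → DifferentiableAt ℂ h w)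
    (hb : ∀ w : ℂ, x₀ ≤ w.re → ‖deriv h w - 1 / 2‖ ≤ 1 / 8) :
    ∃ w w' : ℝ → ℂ, (∀ x, (w x).re = x) ∧ ∀ x, x₀ ≤ x →
      HasDerivAt w (w' x) x ∧ ‖w' x‖ ≤ 2 ∧ (Complex.exp (h (w x)) * w' x).im = 0 ∧
        1 / 4 ≤ (deriv h (w x) * w' x).re := by
  have hre : ∀ w : ℂ, x₀ ≤ w.re → 3 / 8 ≤ (deriv h w).re ∧ (deriv h w).re ≤ 5 / 8 ∧
      |(deriv h w).im| ≤ 1 / 8 := by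
    intro w hw
    have h1 := (Complex.abs_re_le_norm _).trans (hb w hw)
    have h2 := (Complex.abs_im_le_norm _).trans (hb w hw)
    have h3 : ((1 : ℂ) / 2).re = 1 / 2 ∧ ((1 : ℂ) / 2).im = 0 := by constructor <;> norm_num
    rw [Complex.sub_re, h3.1, abs_le] at h1
    rw [Complex.sub_im, h3.2, sub_zero] at h2
    exact ⟨by linarith [h1.1], by linarith [h1.2], h2⟩
  have hslope : ∀ r : ℝ, (1 + (r : ℂ) * Complex.I).re = 1 ∧ (1 + (r : ℂ) * Complex.I).im = r :=
    fun r => by simp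
  have hvert : ∀ x v : ℝ, x₀ ≤ x → HasDerivAt (fun s : ℝ => (h (x + s * Complex.I)).im)
      (deriv h (x + v * Complex.I)).re v := fun x v hx =>
    hasDerivAt_im_vertical (hd _ (by simpa using hx))
  -- `Im h` increases at rate at least `3/8` up the line `Re w = x₀`, so it vanishes within distance
  -- `3 * |k 0|` of the real axis, since `3 * (3/8) > 1`.
  obtain ⟨v₀, hv₀⟩ : ∃ v₀ : ℝ, (h (x₀ + v₀ * Complex.I)).im = 0 := by
    have hdiff : Differentiable ℝ fun s : ℝ => (h (x₀ + s * Complex.I)).im := fun v =>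
      (hvert x₀ v le_rfl).differentiableAt
    have hder : ∀ v, 3 / 8 ≤ deriv (fun s : ℝ => (h (x₀ + s * Complex.I)).im) v := fun v => by
      rw [(hvert x₀ v le_rfl).deriv]
      exact (hre _ (by simp)).1
    set k := fun s : ℝ => (h (x₀ + s * Complex.I)).im
    have hgrow := fun {a b : ℝ} (hab : a ≤ b) =>
      mul_sub_le_image_sub_of_le_deriv hdiff hder hab
    have hpos : 0 ≤ 3 * |k 0| := by positivity
    have h1 := hgrow hpos
    have h2 := hgrow (neg_nonpos.2 hpos)
    have h3 := neg_abs_le (k 0)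
    have h4 := le_abs_self (k 0)
    obtain ⟨v, -, hv⟩ := intermediate_value_Icc ((neg_nonpos.2 hpos).trans hpos)
      hdiff.continuous.continuousOn (show (0 : ℝ) ∈ Set.Icc _ _ from ⟨by linarith, by linarith⟩)
    exact ⟨v, hv⟩
  -- With `θ = Im h`, the direction `1 - i tan θ` has argument `-θ` and cancels the argument of `exp
  -- h`. Since `h` is controlled only for `Re w ≥ x₀`, `max t x₀` freezes the field to the left.
  have hlip : ∀ t : ℝ, LipschitzWith 2 fun v : ℝ =>
      -clampedTan (h ((max t x₀ : ℝ) + v * Complex.I)).im := by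
    intro t
    have h1 : LipschitzWith 1 fun s : ℝ => (h ((max t x₀ : ℝ) + s * Complex.I)).im := by
      refine lipschitzWith_of_nnnorm_deriv_le
        (fun v => (hvert _ v (le_max_right _ _)).differentiableAt) fun v => ?_
      rw [(hvert _ v (le_max_right _ _)).deriv, ← NNReal.coe_le_coe, coe_nnnorm,
        Real.norm_eq_abs, abs_le, NNReal.coe_one]
      have h2 := hre ((max t x₀ : ℝ) + v * Complex.I) (by simp)
      constructor <;> linarith [h2.1, h2.2.1]
    have h3 := (lipschitzWith_clampedTan.comp h1).neg
    rwa [mul_one] at h3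
  obtain ⟨v, hv0, hv⟩ := exists_global_solution (B := 1) hlip (fun v => by
      have h1 : Continuous fun t : ℝ => h ((max t x₀ : ℝ) + v * Complex.I) := by
        rw [continuous_iff_continuousAt]
        intro t
        refine ContinuousAt.comp (g := h) (hd _ (by simp)).continuousAt ?_
        fun_prop
      exact (lipschitzWith_clampedTan.continuous.comp (Complex.continuous_im.comp h1)).neg)
    (fun t v => by simpa using abs_clampedTan_le_one _) x₀ v₀
  set w : ℝ → ℂ := fun x => x + v x * Complex.I with hw
  have hwre : ∀ x, (w x).re = x := fun x => by simp [hw]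
  set θ : ℝ → ℝ := fun x => (h (w x)).im with hθ
  have hv' : ∀ x, x₀ ≤ x → HasDerivAt v (-clampedTan (θ x)) x := by
    intro x hx
    have h1 := hv x
    rwa [max_eq_left hx] at h1
  have hw' : ∀ x, x₀ ≤ x → HasDerivAt w (1 + (-clampedTan (θ x) : ℝ) * Complex.I) x := by
    intro x hx
    exact (Complex.ofRealCLM.hasDerivAt (x := x)).add ((hv' x hx).ofReal_comp.mul_const Complex.I)
  have hθ' : ∀ x, x₀ ≤ x → HasDerivAt θ ((deriv h (w x)).im -
      clampedTan (θ x) * (deriv h (w x)).re) x := by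
    intro x hx
    have h1 := (hd (w x) (by rwa [hwre])).hasDerivAt.comp x (hw' x hx)
    refine (hasDerivAt_im h1).congr_deriv ?_
    rw [Complex.mul_im, (hslope _).1, (hslope _).2]
    ring
  have hpi : 0 < Real.pi / 4 := by positivity
  have hθ0 : θ x₀ = 0 := by simp only [hθ, hw, hv0, hv₀]
  -- A barrier argument: at `θ = π/4` the derivative is at most `1/8 - 3/8 < 0`. With the symmetric
  -- bound below, the clamp is never active.
  have hup : ∀ x, x₀ ≤ x → θ x ≤ Real.pi / 4 := by
    intro x hx
    refine image_le_of_deriv_right_lt_deriv_boundary (a := x₀) (b := x) (B' := fun _ => 0)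
      (fun t ht => (hθ' t ht.1).continuousAt.continuousWithinAt)
      (fun t ht => (hθ' t ht.1).hasDerivWithinAt) (hθ0.trans_le hpi.le)
      (fun t => hasDerivAt_const t (Real.pi / 4)) (fun t ht hteq => ?_) ⟨hx, le_rfl⟩
    have h1 := hre (w t) (by rw [hwre]; exact ht.1)
    rw [hteq, clampedTan_of_mem ⟨by linarith, le_rfl⟩, Real.tan_pi_div_four]
    linarith [(abs_le.1 h1.2.2).2]
  have hlo : ∀ x, x₀ ≤ x → -θ x ≤ Real.pi / 4 := by
    intro x hx
    refine image_le_of_deriv_right_lt_deriv_boundary (a := x₀) (b := x) (B' := fun _ => 0)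
      (fun t ht => (hθ' t ht.1).neg.continuousAt.continuousWithinAt)
      (fun t ht => (hθ' t ht.1).neg.hasDerivWithinAt) (by simpa [hθ0] using hpi.le)
      (fun t => hasDerivAt_const t (Real.pi / 4)) (fun t ht hteq => ?_) ⟨hx, le_rfl⟩
    have h1 := hre (w t) (by rw [hwre]; exact ht.1)
    have h2 : θ t = -(Real.pi / 4) := by
      simp only [Pi.neg_apply] at hteq
      linarith
    rw [h2, clampedTan_of_mem ⟨le_rfl, by linarith⟩, Real.tan_neg, Real.tan_pi_div_four]
    linarith [(abs_le.1 h1.2.2).1]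
  refine ⟨w, fun x => 1 + (-clampedTan (θ x) : ℝ) * Complex.I, hwre,
    fun x hx => ⟨hw' x hx, ?_, ?_, ?_⟩⟩
  · refine (norm_add_le _ _).trans ?_
    have h1 := abs_clampedTan_le_one (θ x)
    simp only [norm_mul, Complex.norm_I, Complex.norm_real, norm_neg, norm_one, Real.norm_eq_abs]
    linarith
  · have hmem : θ x ∈ Set.Icc (-(Real.pi / 4)) (Real.pi / 4) :=
      ⟨by linarith [hlo x hx], hup x hx⟩
    have hcos := (cos_pos_of_mem_Icc_pi_div_four hmem).ne'
    rw [Complex.mul_im, (hslope _).1, (hslope _).2, Complex.exp_re, Complex.exp_im,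
      clampedTan_of_mem hmem, Real.tan_eq_sin_div_cos]
    change Real.exp (h (w x)).re * Real.cos (θ x) * _ +
      Real.exp (h (w x)).re * Real.sin (θ x) * _ = 0
    field_simp
    ring
  · have h1 := hre (w x) (by rwa [hwre])
    have h2 := abs_clampedTan_le_one (θ x)
    have h3 : |clampedTan (θ x) * (deriv h (w x)).im| ≤ 1 * (1 / 8) := by
      rw [abs_mul]
      gcongr
      exact h1.2.2
    rw [Complex.mul_re, (hslope _).1, (hslope _).2]
    linarith [(abs_le.1 h3).1]

/-! ### Energy estimate and Liouville transform. -/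

/-- Solutions of the system `U' = r W`, `W' = -r U + c U` with real `r` and exponentially small
`c` are bounded. -/
theorem exists_bound_of_oscillatory_system {U W c : ℝ → ℂ} {r : ℝ → ℝ} {x₀ q : ℝ}
    (hU : ∀ x, x₀ ≤ x → HasDerivAt U (r x • W x) x)
    (hW : ∀ x, x₀ ≤ x → HasDerivAt W (-(r x • U x) + c x * U x) x)
    (hc : ∀ x, x₀ ≤ x → ‖c x‖ ≤ Real.exp (q - x / 4)) :
    ∃ C, ∀ x, x₀ ≤ x → ‖U x‖ ≤ C := by
  set E : ℝ → ℝ := fun x => ‖U x‖ ^ 2 + ‖W x‖ ^ 2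
  have hE0 : ∀ x, 0 ≤ E x := fun x => by positivity
  -- The terms with real `r` cancel; only the perturbation changes the energy.
  have hE : ∀ x, x₀ ≤ x → HasDerivAt E (2 * inner ℝ (W x) (c x * U x)) x := by
    intro x hx
    refine ((hU x hx).norm_sq.add (hW x hx).norm_sq).congr_deriv ?_
    rw [inner_add_right, inner_neg_right, real_inner_smul_right, real_inner_smul_right,
      real_inner_comm (U x) (W x)]
    ring
  have hE' : ∀ x, x₀ ≤ x → 2 * inner ℝ (W x) (c x * U x) ≤ Real.exp (q - x / 4) * E x := by
    intro x hx
    have h1 := real_inner_le_norm (W x) (c x * U x)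
    rw [norm_mul] at h1
    calc 2 * inner ℝ (W x) (c x * U x) ≤ ‖c x‖ * (2 * ‖U x‖ * ‖W x‖) := by linarith
      _ ≤ Real.exp (q - x / 4) * E x :=
          mul_le_mul (hc x hx) (two_mul_le_add_sq _ _) (by positivity) (Real.exp_pos _).le
  -- An integrating factor: `4 * exp (q - x / 4)` is the integral of `exp (q - x / 4)` over `[x,
  -- ∞)`.
  have hexp : ∀ x, HasDerivAt (fun x => Real.exp (4 * Real.exp (q - x / 4)))
      (-(Real.exp (4 * Real.exp (q - x / 4)) * Real.exp (q - x / 4))) x := by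
    intro x
    refine ((((((hasDerivAt_id x).div_const 4).const_sub q).exp).const_mul 4).exp).congr_deriv ?_
    simp only [id]
    ring
  have hanti : AntitoneOn (fun x => E x * Real.exp (4 * Real.exp (q - x / 4))) (Set.Ici x₀) := by
    refine antitoneOn_of_hasDerivWithinAt_nonpos (convex_Ici x₀)
      (fun x hx => ((hE x hx).mul (hexp x)).continuousAt.continuousWithinAt)
      (fun x hx => ((hE x (interior_subset hx)).mul (hexp x)).hasDerivWithinAt) fun x hx => ?_
    have h1 := hE' x (interior_subset hx)
    have h2 := Real.exp_pos (4 * Real.exp (q - x / 4))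
    nlinarith
  refine ⟨√(E x₀ * Real.exp (4 * Real.exp (q - x₀ / 4))), fun x hx => ?_⟩
  refine Real.le_sqrt_of_sq_le ?_
  calc ‖U x‖ ^ 2 ≤ E x := le_add_of_nonneg_right (by positivity)
    _ ≤ E x * Real.exp (4 * Real.exp (q - x / 4)) :=
        le_mul_of_one_le_right (hE0 x) (Real.one_le_exp (by positivity))
    _ ≤ _ := hanti Set.self_mem_Ici hx hx

/-- The first component of the Liouville transform of `y` in the coordinate `z = φ w`. -/
noncomputable def liouvilleFst (φ y : ℂ → ℂ) (w : ℂ) : ℂ :=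
  Complex.exp (w / 4) * y (φ w)

/-- The second component of the Liouville transform of `y` in the coordinate `z = φ w`; the
function `exp h` is `exp (w / 2) * φ' w`. -/
noncomputable def liouvilleSnd (φ h y : ℂ → ℂ) (w : ℂ) : ℂ :=
  Complex.exp (-(w / 4)) * deriv y (φ w) + liouvilleFst φ y w * Complex.exp (-h w) / 4

section Liouville

variable {A φ h y : ℂ → ℂ} {w h' : ℂ}

theorem hasDerivAt_liouvilleFst (hy : IsSolution A y)
    (hφ : HasDerivAt φ (Complex.exp (h w - w / 2)) w) :
    HasDerivAt (liouvilleFst φ y) (Complex.exp (h w) * liouvilleSnd φ h y w) w := by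
  have h1 : HasDerivAt (fun w => y (φ w)) (deriv y (φ w) * Complex.exp (h w - w / 2)) w :=
    (hy.1 (φ w)).hasDerivAt.comp w hφ
  refine ((((hasDerivAt_id w).div_const 4).cexp).mul h1).congr_deriv ?_
  have h2 : Complex.exp (w / 2) = Complex.exp (w / 4) ^ 2 := by
    rw [← Complex.exp_nat_mul]
    congr 1
    push_cast
    ring
  simp only [liouvilleSnd, liouvilleFst, Complex.exp_sub, Complex.exp_neg, h2, id]
  have h3 := Complex.exp_ne_zero (h w)
  have h4 := Complex.exp_ne_zero (w / 4)
  field_simp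
  ring

/-- The correction term in `liouvilleSnd` absorbs the derivative of the factor `exp (w / 4)`, so
what is left besides the rotation carries the small factor `exp (-h)`. -/
theorem hasDerivAt_liouvilleSnd (hy : IsSolution A y)
    (hφ : HasDerivAt φ (Complex.exp (h w - w / 2)) w) (hh : HasDerivAt h h' w)
    (hA : A (φ w) = Complex.exp w) :
    HasDerivAt (liouvilleSnd φ h y) (-(Complex.exp (h w) * liouvilleFst φ y w) +
      (1 / 4 - h') * Complex.exp (-h w) / 4 * liouvilleFst φ y w) w := by
  have hy' : Differentiable ℂ (deriv y) :=
    (hy.1.contDiff (n := 2)).differentiable_deriv_two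
  have h1 : HasDerivAt (fun w => deriv y (φ w))
      (deriv (deriv y) (φ w) * Complex.exp (h w - w / 2)) w :=
    (hy' (φ w)).hasDerivAt.comp w hφ
  refine (((((hasDerivAt_id w).div_const 4).neg.cexp).mul h1).add
    (((hasDerivAt_liouvilleFst hy hφ).mul hh.neg.cexp).div_const 4)).congr_deriv ?_
  have h5 : deriv (deriv y) (φ w) = -(Complex.exp w * y (φ w)) := by
    rw [← hA]
    linear_combination hy.2 (φ w)
  have h2 : Complex.exp (w / 2) = Complex.exp (w / 4) ^ 2 := by
    rw [← Complex.exp_nat_mul]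
    congr 1
    push_cast
    ring
  have h6 : Complex.exp w = Complex.exp (w / 4) ^ 4 := by
    rw [← Complex.exp_nat_mul]
    congr 1
    push_cast
    ring
  rw [h5]
  simp only [liouvilleSnd, liouvilleFst, Complex.exp_sub, Complex.exp_neg, h2, h6, id,
    Pi.neg_apply]
  have h3 := Complex.exp_ne_zero (h w)
  have h4 := Complex.exp_ne_zero (w / 4)
  field_simp
  ring

end Liouville

/-! ### Decay of solutions in the logarithmic coordinate. -/

/-- Decay of all solutions along a curve in logarithmic coordinates. -/
theorem tendsto_solution_along_curve {A φ h y : ℂ → ℂ} {w w' : ℝ → ℂ} {x₀ : ℝ}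
    (hy : IsSolution A y)
    (hφ : ∀ ζ : ℂ, x₀ ≤ ζ.re → HasDerivAt φ (Complex.exp (h ζ - ζ / 2)) ζ)
    (hA : ∀ ζ : ℂ, x₀ ≤ ζ.re → A (φ ζ) = Complex.exp ζ)
    (hd : ∀ ζ : ℂ, x₀ ≤ ζ.re → DifferentiableAt ℂ h ζ)
    (hb : ∀ ζ : ℂ, x₀ ≤ ζ.re → ‖deriv h ζ - 1 / 2‖ ≤ 1 / 8)
    (hre : ∀ x, (w x).re = x)
    (hw : ∀ x, x₀ ≤ x → HasDerivAt w (w' x) x ∧ ‖w' x‖ ≤ 2 ∧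
      (Complex.exp (h (w x)) * w' x).im = 0 ∧ 1 / 4 ≤ (deriv h (w x) * w' x).re) :
    Tendsto (fun x => y (φ (w x))) atTop (𝓝 0) := by
  have hmem : ∀ x, x₀ ≤ x → x₀ ≤ (w x).re := fun x hx => by rwa [hre]
  -- `Re h` grows at least linearly along the curve
  have hgrow : ∀ x, x₀ ≤ x → (h (w x₀)).re + (x - x₀) / 4 ≤ (h (w x)).re := by
    have hder : ∀ x, x₀ ≤ x →
        HasDerivAt (fun x => (h (w x)).re - x / 4) ((deriv h (w x) * w' x).re - 1 / 4) x :=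
      fun x hx => (hasDerivAt_re ((hd _ (hmem x hx)).hasDerivAt.comp x (hw x hx).1)).sub
        ((hasDerivAt_id x).div_const 4)
    have hmono : MonotoneOn (fun x => (h (w x)).re - x / 4) (Set.Ici x₀) :=
      monotoneOn_of_hasDerivWithinAt_nonneg (convex_Ici x₀)
        (fun x hx => (hder x hx).continuousAt.continuousWithinAt)
        (fun x hx => (hder x (interior_subset hx)).hasDerivWithinAt)
        fun x hx => by linarith [(hw x (interior_subset hx)).2.2.2]
    intro x hx
    have h1 := hmono Set.self_mem_Ici hx hx
    simp only at h1
    linarith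
  -- The choice of `q` comes from `hgrow`: the coefficient is at most `2 * exp (-Re h) / 4 * 2 = exp
  -- (-Re h)`.
  obtain ⟨C, hC⟩ := exists_bound_of_oscillatory_system (x₀ := x₀)
    (q := x₀ / 4 - (h (w x₀)).re)
    (U := fun x => liouvilleFst φ y (w x)) (W := fun x => liouvilleSnd φ h y (w x))
    (r := fun x => (Complex.exp (h (w x)) * w' x).re)
    (c := fun x => (1 / 4 - deriv h (w x)) * Complex.exp (-h (w x)) / 4 * w' x)
    (fun x hx => by
      refine ((hasDerivAt_liouvilleFst hy (hφ _ (hmem x hx))).comp x (hw x hx).1).congr_deriv ?_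
      have h1 : ((Complex.exp (h (w x)) * w' x).re : ℂ) = Complex.exp (h (w x)) * w' x :=
        Complex.ext (by simp) (by simpa using (hw x hx).2.2.1.symm)
      rw [Complex.real_smul, h1]
      ring)
    (fun x hx => by
      refine ((hasDerivAt_liouvilleSnd hy (hφ _ (hmem x hx)) (hd _ (hmem x hx)).hasDerivAt
        (hA _ (hmem x hx))).comp x (hw x hx).1).congr_deriv ?_
      have h1 : ((Complex.exp (h (w x)) * w' x).re : ℂ) = Complex.exp (h (w x)) * w' x :=
        Complex.ext (by simp) (by simpa using (hw x hx).2.2.1.symm)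
      rw [Complex.real_smul, h1]
      ring)
    (fun x hx => by
      have h1 : ‖1 / 4 - deriv h (w x)‖ ≤ 2 := by
        have h2 : 1 / 4 - deriv h (w x) = -(deriv h (w x) - 1 / 2) - 1 / 4 := by ring
        rw [h2]
        refine (norm_sub_le _ _).trans ?_
        rw [norm_neg]
        have h3 : ‖(1 : ℂ) / 4‖ ≤ 1 := by norm_num
        linarith [hb _ (hmem x hx)]
      have h4 : ‖Complex.exp (-h (w x))‖ ≤ Real.exp (x₀ / 4 - (h (w x₀)).re - x / 4) := by
        rw [Complex.norm_exp, Complex.neg_re]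
        gcongr
        linarith [hgrow x hx]
      rw [norm_mul, norm_div, norm_mul, Complex.norm_ofNat]
      calc ‖1 / 4 - deriv h (w x)‖ * ‖Complex.exp (-h (w x))‖ / 4 * ‖w' x‖
          ≤ 2 * Real.exp (x₀ / 4 - (h (w x₀)).re - x / 4) / 4 * 2 := by
            gcongr
            exact (hw x hx).2.1
        _ = _ := by ring)
  have hlim : Tendsto (fun x : ℝ => Real.exp (-(x / 4)) * C) atTop (𝓝 0) := by
    have h1 : Tendsto (fun x : ℝ => Real.exp (-(x / 4))) atTop (𝓝 0) :=
      Real.tendsto_exp_neg_atTop_nhds_zero.comp (tendsto_id.atTop_div_const (by norm_num))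
    simpa using h1.mul_const C
  refine squeeze_zero_norm' ?_ hlim
  filter_upwards [eventually_ge_atTop x₀] with x hx
  have h1 : y (φ (w x)) = Complex.exp (-(w x / 4)) * liouvilleFst φ y (w x) := by
    rw [liouvilleFst, ← mul_assoc, ← Complex.exp_add]
    simp
  have h2 : (-(w x / 4)).re = -(x / 4) := by
    simp [hre]
  rw [h1, norm_mul, Complex.norm_exp, h2]
  gcongr
  exact hC x hx

/-- A univalent change of variables `φ` on a half-plane with `A (φ w) = exp w` yields a curve on
which all solutions tend to zero. -/
theorem exists_curve_tendsto_solution {A φ : ℂ → ℂ} {a : ℝ}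
    (hφ : DifferentiableOn ℂ φ {w | a < w.re}) (hinj : Set.InjOn φ {w | a < w.re})
    (hA : ∀ w : ℂ, a < w.re → A (φ w) = Complex.exp w) :
    ∃ x₀ > a, ∃ w : ℝ → ℂ, (∀ x, (w x).re = x) ∧ ContinuousOn w (Set.Ici x₀) ∧
      ∀ y, IsSolution A y → Tendsto (fun x => y (φ (w x))) atTop (𝓝 0) := by
  have hopen : IsOpen {w : ℂ | a < w.re} := isOpen_lt continuous_const Complex.continuous_re
  have hφ' : ∀ w : ℂ, a < w.re → deriv φ w ≠ 0 := fun w hw =>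
    deriv_ne_zero_of_injOn hopen hφ hinj hw
  obtain ⟨ℓ, hℓ, hexp⟩ := exists_differentiableOn_exp_eq hopen (convex_halfSpace_re_gt a)
    ⟨(a + 1 : ℝ), by simp⟩ (hφ.deriv hopen) hφ'
  have hℓ' : ∀ w : ℂ, a < w.re → ‖deriv ℓ w‖ ≤ 1760 / (w.re - a) := by
    intro w hw
    have hwU : {w : ℂ | a < w.re} ∈ 𝓝 w := hopen.mem_nhds hw
    have hball : Metric.ball w (w.re - a) ⊆ {w : ℂ | a < w.re} := by
      intro ζ hζ
      rw [Metric.mem_ball, dist_eq_norm] at hζ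
      have h1 := (abs_le.1 ((Complex.abs_re_le_norm (ζ - w)))).1
      rw [Complex.sub_re] at h1
      change a < ζ.re
      linarith
    have h1 := norm_deriv_deriv_le_of_injOn_ball (sub_pos.2 hw) (hφ.mono hball)
      (hinj.mono hball)
    have h2 : deriv (deriv φ) w = deriv φ w * deriv ℓ w := by
      have h3 : HasDerivAt (fun w => Complex.exp (ℓ w)) (Complex.exp (ℓ w) * deriv ℓ w) w :=
        (hℓ.differentiableAt hwU).hasDerivAt.cexp
      rw [hexp w hw] at h3
      refine (h3.congr_of_eventuallyEq ?_).deriv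
      filter_upwards [hwU] with ζ hζ
      exact (hexp ζ hζ).symm
    rw [h2, norm_mul, mul_comm] at h1
    exact le_of_mul_le_mul_right h1 (norm_pos_iff.2 (hφ' w hw))
  -- `14080 = 8 * 1760`, which makes the bound in `hℓ'` at most `1/8`.
  have hlt : ∀ w : ℂ, a + 14080 ≤ w.re → a < w.re := fun w hw => by linarith
  have hder : ∀ w : ℂ, a + 14080 ≤ w.re →
      HasDerivAt (fun w => w / 2 + ℓ w) (1 / 2 + deriv ℓ w) w := fun w hw =>
    ((hasDerivAt_id w).div_const 2).add
      (hℓ.differentiableAt (hopen.mem_nhds (hlt w hw))).hasDerivAt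
  have hb : ∀ w : ℂ, a + 14080 ≤ w.re →
      ‖deriv (fun w => w / 2 + ℓ w) w - 1 / 2‖ ≤ 1 / 8 := by
    intro w hw
    rw [(hder w hw).deriv, add_sub_cancel_left]
    refine (hℓ' w (hlt w hw)).trans ?_
    rw [div_le_iff₀ (by linarith)]
    linarith
  obtain ⟨w, w', hre, hw⟩ := exists_curve_exp_mul_deriv_real
    (fun w hw => (hder w hw).differentiableAt) hb
  refine ⟨a + 14080, by linarith, w, hre,
    fun x hx => (hw x hx).1.continuousAt.continuousWithinAt, fun y hy => ?_⟩
  refine tendsto_solution_along_curve hy (fun ζ hζ => ?_) (fun ζ hζ => hA ζ (hlt ζ hζ))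
    (fun w hw => (hder w hw).differentiableAt) hb hre hw
  rw [add_sub_cancel_left, hexp ζ (hlt ζ hζ)]
  exact (hφ.differentiableAt (hopen.mem_nhds (hlt ζ hζ))).hasDerivAt

/-! ### Neighbourhoods of the singularity and the conclusion. -/

theorem IsSingularityNhd.eventually_mem {f : ℂ → ℂ} {γ : ℝ≥0 → ℂ} {M : ℝ} {Ω : Set ℂ}
    (hΩ : IsSingularityNhd f γ M Ω) (hγ : IsPathToInfinity γ) : ∀ᶠ t in atTop, γ t ∈ Ω := by
  filter_upwards [hγ.2.eventually (Bornology.isBounded_def.1 hΩ.2.2)] with t ht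
  by_contra h
  exact ht ⟨Set.mem_range_self t, h⟩

/-- A connected subset of `{z | M < |f z|}` containing points `γ t` with arbitrarily large `t` lies
in the neighbourhood with parameter `M` of the singularity determined by `γ`. -/
theorem IsSingularityNhd.subset_of_isPreconnected {f : ℂ → ℂ} {γ : ℝ≥0 → ℂ} {M : ℝ}
    {Ω S : Set ℂ} (hΩ : IsSingularityNhd f γ M Ω) (hγ : IsPathToInfinity γ)
    (hS : IsPreconnected S) (hSM : ∀ z ∈ S, M < ‖f z‖) (hSγ : ∀ᶠ t in atTop, γ t ∈ S) :
    S ⊆ Ω := by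
  obtain ⟨t, htΩ, htS⟩ := ((hΩ.eventually_mem hγ).and hSγ).exists
  obtain ⟨z₀, -, rfl⟩ := hΩ.2.1
  rw [connectedComponentIn_eq htΩ]
  exact hS.subset_connectedComponentIn htS hSM

theorem mainTheorem6 (A : ℂ → ℂ) (hA : IsTranscendentalEntire A)
    (γ : ℝ≥0 → ℂ) (hγ : IsLogarithmicSingularity A γ)
    (M : ℝ) (Ω : Set ℂ) (hΩ : IsSingularityNhd A γ M Ω) :
    ∃ Γ : ℝ≥0 → ℂ, IsPathToInfinity Γ ∧ (∀ t, Γ t ∈ Ω) ∧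
      ∀ y : ℂ → ℂ, IsSolution A y → Tendsto (fun t => y (Γ t)) atTop (𝓝 0) := by
  obtain ⟨⟨hpath, hAγ⟩, M₀, Ω₀, hΩ₀, L, hL, hexp, hbij⟩ := hγ
  have hΩ₀open : IsOpen Ω₀ := by
    obtain ⟨z₀, -, rfl⟩ := hΩ₀.2.1
    exact (isOpen_lt continuous_const hA.1.continuous.norm).connectedComponentIn
  set a := Real.log M₀
  have hinv := hbij.invOn_invFunOn
  have hmaps : ∀ w : ℂ, a < w.re → Function.invFunOn L Ω₀ w ∈ Ω₀ := fun w hw =>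
    hbij.surjOn.mapsTo_invFunOn hw
  set φ := Function.invFunOn L Ω₀
  have hφ : DifferentiableOn ℂ φ {w | a < w.re} := by
    intro w hw
    have h1 := differentiableAt_leftInvOn hΩ₀open hL hinv.1 (hmaps w hw)
    rw [hinv.2 hw] at h1
    exact h1.differentiableWithinAt
  have hAφ : ∀ w : ℂ, a < w.re → A (φ w) = Complex.exp w := fun w hw => by
    rw [← hexp _ (hmaps w hw), hinv.2 hw]
  obtain ⟨x₀, hx₀, w, hre, hwc, hdecay⟩ := exists_curve_tendsto_solution hφ hinv.2.injOn hAφ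
  -- The image of this smaller half-plane is connected, has `|A| > M` on it, and contains a tail of
  -- `γ` because `Re L = log |A| → ∞` along `γ`.
  have hS : φ '' {w : ℂ | max a (Real.log M) < w.re} ⊆ Ω := by
    have hsub : {w : ℂ | max a (Real.log M) < w.re} ⊆ {w | a < w.re} := fun w hw =>
      lt_of_le_of_lt (le_max_left a (Real.log M)) hw
    refine hΩ.subset_of_isPreconnected hpath ?_ ?_ ?_
    · exact (convex_halfSpace_re_gt _).isPreconnected.image φ (hφ.continuousOn.mono hsub)
    · rintro _ ⟨ζ, hζ, rfl⟩
      rw [hAφ ζ (hsub hζ), Complex.norm_exp, ← Real.log_lt_iff_lt_exp hΩ.1]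
      exact (le_max_right _ _).trans_lt hζ
    · filter_upwards [hΩ₀.eventually_mem hpath, (tendsto_norm_cobounded_atTop.comp
        hAγ).eventually_gt_atTop (Real.exp (max a (Real.log M)))] with t ht hbig
      refine ⟨L (γ t), ?_, hinv.1 ht⟩
      rw [Function.comp_apply, ← hexp _ ht, Complex.norm_exp, Real.exp_lt_exp] at hbig
      exact hbig
  -- Starting at `x₁` keeps the whole curve in the half-plane of `hS`.
  set x₁ := max x₀ (Real.log M + 1)
  have hshift : Tendsto (fun t : ℝ≥0 => x₁ + (t : ℝ)) atTop atTop :=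
    tendsto_atTop_add_const_left _ _ (NNReal.tendsto_coe_atTop.2 tendsto_id)
  have hge : ∀ t : ℝ≥0, x₀ ≤ x₁ + t := fun t =>
    (le_max_left _ _).trans (le_add_of_nonneg_right t.coe_nonneg)
  have hmem : ∀ t : ℝ≥0, a < (w (x₁ + t)).re := fun t => by
    rw [hre]
    exact hx₀.trans_le (hge t)
  refine ⟨fun t => φ (w (x₁ + t)), ⟨?_, ?_⟩, fun t => hS ⟨w (x₁ + t), ?_, rfl⟩,
    fun y hy => (hdecay y hy).comp hshift⟩
  · exact hφ.continuousOn.comp_continuous (hwc.comp_continuous (by fun_prop) hge) hmem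
  -- `Γ` leaves every disc because `|A|` tends to infinity on it while `A` is bounded on compact
  -- sets.
  · have h1 : Tendsto (fun t : ℝ≥0 => ‖A (φ (w (x₁ + t)))‖) atTop atTop := by
      have h2 : ∀ t : ℝ≥0, ‖A (φ (w (x₁ + t)))‖ = Real.exp (x₁ + t) := fun t => by
        rw [hAφ _ (hmem t), Complex.norm_exp, hre]
      simp only [h2]
      exact Real.tendsto_exp_atTop.comp hshift
    rw [(Metric.hasBasis_cobounded_compl_closedBall (0 : ℂ)).tendsto_right_iff]
    intro R _
    obtain ⟨C, hC⟩ := (isCompact_closedBall (0 : ℂ) R).exists_bound_of_continuousOn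
      hA.1.continuous.continuousOn
    filter_upwards [h1.eventually_gt_atTop C] with t ht hmem
    exact (hC _ hmem).not_gt ht
  · change max a (Real.log M) < (w (x₁ + t)).re
    refine max_lt (hmem t) ?_
    rw [hre]
    have h1 : Real.log M + 1 ≤ x₁ := le_max_right _ _
    linarith [t.coe_nonneg]
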